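/- Let $G$ be a finite simple graph of order $n\ge 2$ with $m$ edges, and let $\mu_1\ge\mu_2\ge\cdots\ge\mu_n=0$ be the eigenvalues, counted with multiplicity, of its Laplacian matrix $L(G)=D(G)-A(G)$, where $D(G)$ is the diagonal matrix of vertex degrees and $A(G)$ is the adjacency matrix. Let $\sigma(G)$ be the largest integer $i\in\{1,\dots,n\}$ such that $\mu_i\ge \frac{2m}{n}$, the average degree of $G$. Then $\sigma(G)=1$ if and only if $$G\cong K_{1,\,n-r-1}\cup r\,K_1\quad\text{for some integer } r\ge 0 \text{ with } r\le \left\lceil\tfrac n2\right\rceil-2 \ \text{ or } \ r=n-2,$$ where $K_{1,\,n-r-1}\cup r\,K_1$ denotes the disjoint union of the star with $n-r-1$ edges and $r$ isolated vertices. -/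

import Mathlib

/-- The `i`-th largest eigenvalue `μ_i` (counted with multiplicity, `1 ≤ i ≤ |V|`) of the
Laplacian matrix `L(G) = D(G) - A(G)`. Since `Fin` counts from zero, `μ_i` is the entry of index
`i - 1` in the decreasing list of eigenvalues. -/
noncomputable def laplacianEigenvalue {V : Type*} [Fintype V] [DecidableEq V]
    (G : SimpleGraph V) [DecidableRel G.Adj] (i : ℕ)
    (hi : 1 ≤ i ∧ i ≤ Fintype.card V) : ℝ :=
  (G.isHermitian_lapMatrix ℝ).eigenvalues₀ ⟨i - 1, by omega⟩

/-- The average degree `2m / n` of a graph with `n` vertices and `m` edges. -/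
noncomputable def avgDegree {V : Type*} [Fintype V]
    (G : SimpleGraph V) [DecidableRel G.Adj] : ℝ :=
  2 * (G.edgeFinset.card : ℝ) / (Fintype.card V : ℝ)

/-- `σ(G)`: the largest `i` in `{1, …, |V|}` such that `μ_i` is at least the average degree.
The set is bounded by `|V|`, so its supremum in `ℕ` is its maximum. -/
noncomputable def sigmaInvariant {V : Type*} [Fintype V] [DecidableEq V]
    (G : SimpleGraph V) [DecidableRel G.Adj] : ℕ :=
  sSup {i : ℕ | ∃ hi : 1 ≤ i ∧ i ≤ Fintype.card V, avgDegree G ≤ laplacianEigenvalue G i hi}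

/-- The graph `K_{1,s} ∪ r K_1`: the disjoint union of a star with `s` edges and `r` isolated
vertices. -/
def starWithIsolated (s r : ℕ) : SimpleGraph ((Fin 1 ⊕ Fin s) ⊕ Fin r) :=
  (completeBipartiteGraph (Fin 1) (Fin s)) ⊕g (⊥ : SimpleGraph (Fin r))

/-! Write d = 2m/n. Since μ_1 is at least the maximum degree, hence at least d, σ(G) = 1 means μ_2 <
d. By Courant–Fischer, this fails as soon as the form of L − d is nonnegative on some plane, and it
is proved by bounding the form on a hyperplane.

The main step (`exists_center_of_eigenvalues₀_one_lt`) is that μ_2 < d forces all edges through one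
vertex. If two vertices have degree at least d, they are adjacent, and `degree_le_eigenvalues₀_one`
makes the smaller degree 1; then d ≤ 1, and these two vertices span the only edge. Otherwise a
single u has degree at least d; let k < d be the largest other degree. If k ≥ 2, double counting
finds an edge vw with v a neighbour of u of degree k and w of degree close to k, and the plane of
e_u and e_v − s e_w gives μ_2 ≥ d. If k ≤ 1, an edge missing u is a K_2 component, with eigenvalue 2
≥ d.

A star with s edges and isolated vertices has d = 2s/n, and μ_2 is 1 if s ≥ 2, else 0. So μ_2 < d
exactly when s = 1 or 2s > n. -/

open Matrix

/-! ### Variational bounds for the two largest eigenvalues -/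

namespace Matrix.IsHermitian

variable {V : Type*} [Fintype V] [DecidableEq V] {A : Matrix V V ℝ}

/-- A real symmetric matrix is diagonal in orthonormal coordinates, with its eigenvalues in
decreasing order. -/
lemma exists_linearEquiv_diagonalizing (hA : A.IsHermitian) :
    ∃ e : (V → ℝ) ≃ₗ[ℝ] (Fin (Fintype.card V) → ℝ), ∀ x,
      x ⬝ᵥ x = ∑ i, e x i ^ 2 ∧ x ⬝ᵥ A *ᵥ x = ∑ i, hA.eigenvalues₀ i * e x i ^ 2 := by
  have hT := isSymmetric_toEuclideanLin_iff.mpr hA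
  have hn : Module.finrank ℝ (EuclideanSpace ℝ V) = Fintype.card V := finrank_euclideanSpace
  let B := hT.eigenvectorBasis hn
  refine ⟨(WithLp.linearEquiv 2 ℝ (V → ℝ)).symm ≪≫ₗ B.repr.toLinearEquiv ≪≫ₗ
    WithLp.linearEquiv 2 ℝ _, fun x => ?_⟩
  have hinner : ∀ y : V → ℝ, x ⬝ᵥ y =
      ∑ i, B.repr (WithLp.toLp 2 x) i * B.repr (WithLp.toLp 2 y) i := by
    intro y
    have h := B.repr.inner_map_map (WithLp.toLp 2 x) (WithLp.toLp 2 y)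
    rw [EuclideanSpace.inner_eq_star_dotProduct, EuclideanSpace.inner_eq_star_dotProduct] at h
    simp only [star_trivial] at h
    rw [dotProduct_comm, ← h, dotProduct_comm]
    rfl
  constructor
  · rw [hinner]
    exact Finset.sum_congr rfl fun i _ => by rw [sq]; rfl
  · rw [hinner]
    refine Finset.sum_congr rfl fun i _ => ?_
    have h := hT.eigenvectorBasis_apply_self_apply hn (WithLp.toLp 2 x) i
    have h2 : B.repr (WithLp.toLp 2 (A *ᵥ x)) i =
        hA.eigenvalues₀ i * B.repr (WithLp.toLp 2 x) i := h
    rw [h2]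
    change _ = hA.eigenvalues₀ i * (B.repr (WithLp.toLp 2 x) i) ^ 2
    ring

lemma le_eigenvalues₀_zero (hA : A.IsHermitian) (h : 0 < Fintype.card V) {d : ℝ} {x : V → ℝ}
    (hx : x ≠ 0) (hd : d * (x ⬝ᵥ x) ≤ x ⬝ᵥ A *ᵥ x) : d ≤ hA.eigenvalues₀ ⟨0, h⟩ := by
  obtain ⟨e, he⟩ := hA.exists_linearEquiv_diagonalizing
  have hpos : 0 < x ⬝ᵥ x := by
    simpa using dotProduct_star_self_pos_iff.2 hx
  refine le_of_mul_le_mul_right (hd.trans ?_) hpos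
  rw [(he x).1, (he x).2, Finset.mul_sum]
  refine Finset.sum_le_sum fun i _ => mul_le_mul_of_nonneg_right ?_ (sq_nonneg _)
  exact hA.eigenvalues₀_antitone (Nat.zero_le _)

/-- If the quadratic form is at least `d` times the squared norm on a plane, then the second
largest eigenvalue is at least `d`. -/
lemma le_eigenvalues₀_one (hA : A.IsHermitian) (h : 1 < Fintype.card V) {d : ℝ} {x y : V → ℝ}
    (hxy : ∀ α β : ℝ, α • x + β • y = 0 → α = 0 ∧ β = 0)
    (hd : ∀ α β : ℝ, d * ((α • x + β • y) ⬝ᵥ (α • x + β • y)) ≤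
      (α • x + β • y) ⬝ᵥ A *ᵥ (α • x + β • y)) : d ≤ hA.eigenvalues₀ ⟨1, h⟩ := by
  obtain ⟨e, he⟩ := hA.exists_linearEquiv_diagonalizing
  -- The plane contains a nonzero vector orthogonal to the top eigenvector; only eigenvalues from
  -- the second on act on it.
  obtain ⟨α, β, hz, h0⟩ : ∃ α β : ℝ, α • x + β • y ≠ 0 ∧
      e (α • x + β • y) ⟨0, by omega⟩ = 0 := by
    by_cases h1 : e x ⟨0, by omega⟩ = 0
    · refine ⟨1, 0, fun h2 => one_ne_zero (hxy _ _ h2).1, by simpa using h1⟩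
    · refine ⟨e y ⟨0, by omega⟩, - e x ⟨0, by omega⟩,
        fun h2 => h1 (neg_eq_zero.1 (hxy _ _ h2).2), ?_⟩
      simp only [map_add, map_smul, Pi.add_apply, Pi.smul_apply, smul_eq_mul]
      ring
  have hd := hd α β
  set z := α • x + β • y
  have hpos : 0 < z ⬝ᵥ z := by
    simpa using dotProduct_star_self_pos_iff.2 hz
  refine le_of_mul_le_mul_right (hd.trans ?_) hpos
  rw [(he z).1, (he z).2, Finset.mul_sum]
  refine Finset.sum_le_sum fun i _ => ?_
  by_cases hi : i.1 = 0
  · have : i = ⟨0, by omega⟩ := Fin.ext hi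
    rw [this, h0]
    simp
  · refine mul_le_mul_of_nonneg_right (hA.eigenvalues₀_antitone ?_) (sq_nonneg _)
    exact Fin.mk_le_of_le_val (by omega)

/-- If the quadratic form is at most `d` times the squared norm on a hyperplane, then the second
largest eigenvalue is at most `d`. -/
lemma eigenvalues₀_one_le (hA : A.IsHermitian) (h : 1 < Fintype.card V) {d : ℝ}
    (φ : (V → ℝ) →ₗ[ℝ] ℝ) (hd : ∀ x, φ x = 0 → x ⬝ᵥ A *ᵥ x ≤ d * (x ⬝ᵥ x)) :
    hA.eigenvalues₀ ⟨1, h⟩ ≤ d := by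
  obtain ⟨e, he⟩ := hA.exists_linearEquiv_diagonalizing
  set i0 : Fin (Fintype.card V) := ⟨0, by omega⟩
  set i1 : Fin (Fintype.card V) := ⟨1, h⟩
  have h01 : i0 ≠ i1 := by simp [i0, i1]
  -- The span of the top two eigenvectors meets the hyperplane φ = 0 in a nonzero vector.
  obtain ⟨c, hc0, hc, hφ⟩ : ∃ c : Fin (Fintype.card V) → ℝ, c ≠ 0 ∧
      (∀ i, i ≠ i0 → i ≠ i1 → c i = 0) ∧ φ (e.symm c) = 0 := by
    by_cases h1 : φ (e.symm (Pi.single i0 1)) = 0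
    · exact ⟨Pi.single i0 1, by simp, fun i hi _ => by simp [hi], h1⟩
    · refine ⟨φ (e.symm (Pi.single i1 1)) • Pi.single i0 1 -
        φ (e.symm (Pi.single i0 1)) • Pi.single i1 1, fun h2 => h1 ?_, fun i hi hi' => ?_, ?_⟩
      · have := congrFun h2 i1
        simpa [h01.symm] using this
      · simp [hi, hi']
      · simp only [map_sub, map_smul, smul_eq_mul]
        ring
  have hx : e.symm c ≠ 0 := by simpa using hc0
  have hd := hd _ hφ
  have hpos : 0 < e.symm c ⬝ᵥ e.symm c := by
    simpa using dotProduct_star_self_pos_iff.2 hx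
  refine le_of_mul_le_mul_right (le_trans ?_ hd) hpos
  rw [(he _).1, (he _).2, Finset.mul_sum]
  refine Finset.sum_le_sum fun i _ => ?_
  rw [e.apply_symm_apply]
  by_cases hi : i.1 ≤ 1
  · exact mul_le_mul_of_nonneg_right (hA.eigenvalues₀_antitone hi) (sq_nonneg _)
  · rw [hc i (fun h => hi (by simp [h, i0])) (fun h => hi (by simp [h, i1]))]
    simp

end Matrix.IsHermitian

/-! ### Test planes for the Laplacian -/

section Laplacian

variable {V : Type*} [Fintype V] [DecidableEq V] (G : SimpleGraph V) [DecidableRel G.Adj]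

omit [DecidableEq V] in
lemma avgDegree_mul_card [Nonempty V] :
    avgDegree G * Fintype.card V = ∑ v, (G.degree v : ℝ) := by
  have h : (Fintype.card V : ℝ) ≠ 0 := by simp
  rw [avgDegree, div_mul_cancel₀ _ h]
  exact_mod_cast (G.sum_degrees_eq_twice_card_edges).symm

omit [DecidableEq V] in
lemma exists_avgDegree_le_degree [Nonempty V] : ∃ v, avgDegree G ≤ G.degree v := by
  by_contra! h
  have := Finset.sum_lt_sum_of_nonempty Finset.univ_nonempty fun v _ => h v
  rw [← avgDegree_mul_card] at this
  simp [mul_comm] at this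

lemma single_dotProduct_lapMatrix_mulVec_single (u v : V) (α β : ℝ) :
    Pi.single u α ⬝ᵥ G.lapMatrix ℝ *ᵥ Pi.single v β = G.lapMatrix ℝ u v * (α * β) := by
  simp only [single_dotProduct, mulVec_single, Pi.smul_apply, MulOpposite.smul_eq_mul_unop,
    MulOpposite.unop_op, col_apply]
  ring

lemma lapMatrix_apply_self (u : V) : G.lapMatrix ℝ u u = G.degree u := by
  simp [SimpleGraph.lapMatrix, SimpleGraph.degMatrix]

lemma lapMatrix_apply_of_ne {u v : V} (h : u ≠ v) :
    G.lapMatrix ℝ u v = -(if G.Adj u v then 1 else 0) := by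
  simp [SimpleGraph.lapMatrix, SimpleGraph.degMatrix, h]

lemma sigmaInvariant_eq_one_iff (h : 1 < Fintype.card V) :
    sigmaInvariant G = 1 ↔ (G.isHermitian_lapMatrix ℝ).eigenvalues₀ ⟨1, h⟩ < avgDegree G := by
  have : Nonempty V := Fintype.card_pos_iff.1 (by omega)
  have hbdd : BddAbove {i : ℕ | ∃ hi : 1 ≤ i ∧ i ≤ Fintype.card V,
      avgDegree G ≤ laplacianEigenvalue G i hi} :=
    ⟨Fintype.card V, fun i hi => hi.1.2⟩
  constructor
  · intro hs
    by_contra! h2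
    have : 2 ≤ sigmaInvariant G := le_csSup hbdd ⟨⟨by omega, h⟩, h2⟩
    omega
  · intro hlt
    apply le_antisymm
    · refine csSup_le' ?_
      rintro i ⟨hi, hle⟩
      by_contra! h1
      refine absurd (hle.trans ?_) (not_le.2 hlt)
      refine (G.isHermitian_lapMatrix ℝ).eigenvalues₀_antitone ?_
      exact Fin.mk_le_mk.2 (by omega)
    -- The index 1 must belong to the set, as `sSup ∅ = 0` in ℕ. The indicator of a vertex v has
    -- Rayleigh quotient deg v.
    · refine le_csSup hbdd ⟨⟨le_rfl, h.le⟩, ?_⟩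
      obtain ⟨v, hv⟩ := exists_avgDegree_le_degree G
      refine (G.isHermitian_lapMatrix ℝ).le_eigenvalues₀_zero (x := Pi.single v 1) _ (by simp) ?_
      rw [single_dotProduct_lapMatrix_mulVec_single, lapMatrix_apply_self]
      simpa using hv

lemma quadratic_nonneg_of_sq_le_mul {a b c : ℝ} (ha : 0 ≤ a) (hc : 0 ≤ c) (h : b ^ 2 ≤ a * c)
    (α β : ℝ) : 0 ≤ a * α ^ 2 + 2 * b * (α * β) + c * β ^ 2 := by
  rcases ha.eq_or_lt with rfl | ha
  · have : b = 0 := by nlinarith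
    subst this
    have := mul_nonneg hc (sq_nonneg β)
    nlinarith
  · refine nonneg_of_mul_nonneg_right ?_ ha
    have : a * (a * α ^ 2 + 2 * b * (α * β) + c * β ^ 2) =
        (a * α + b * β) ^ 2 + (a * c - b ^ 2) * β ^ 2 := by ring
    rw [this]
    have := mul_nonneg (sub_nonneg.2 h) (sq_nonneg β)
    positivity

variable {G}

/-- Without the edge uv, the form on the span of e_u and e_v is diagonal, with entries deg u and deg
v. -/
lemma le_eigenvalues₀_one_of_not_adj (h : 1 < Fintype.card V) {u v : V} {d : ℝ} (huv : u ≠ v)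
    (hadj : ¬ G.Adj u v) (hu : d ≤ G.degree u) (hv : d ≤ G.degree v) :
    d ≤ (G.isHermitian_lapMatrix ℝ).eigenvalues₀ ⟨1, h⟩ := by
  refine (G.isHermitian_lapMatrix ℝ).le_eigenvalues₀_one h (x := Pi.single u 1)
    (y := Pi.single v 1) (fun α β h0 => ?_) fun α β => ?_
  · have h1 := congrFun h0 u
    have h2 := congrFun h0 v
    simp [huv, huv.symm] at h1 h2
    exact ⟨h1, h2⟩
  · have hadj' : ¬ G.Adj v u := fun h => hadj h.symm
    simp only [← Pi.single_smul, smul_eq_mul, mul_one, mulVec_add, dotProduct_add, add_dotProduct,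
      single_dotProduct_lapMatrix_mulVec_single, lapMatrix_apply_self,
      lapMatrix_apply_of_ne G huv, lapMatrix_apply_of_ne G huv.symm, hadj, hadj', if_false]
    simp only [single_dotProduct, Pi.single_eq_same, Pi.single_eq_of_ne huv, Pi.single_eq_of_ne huv.symm]
    have := mul_nonneg (sub_nonneg.2 hu) (sq_nonneg α)
    have := mul_nonneg (sub_nonneg.2 hv) (sq_nonneg β)
    nlinarith

/-- A lower bound for the second largest Laplacian eigenvalue from the plane spanned by the
indicator `e_u` and `e_v - s e_w`. -/
lemma le_eigenvalues₀_one_of_three_vertices (h : 1 < Fintype.card V) {u v w : V} {d s : ℝ}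
    (huv : u ≠ v) (huw : u ≠ w) (hvw : v ≠ w) (hu : d ≤ G.degree u)
    (hc : 0 ≤ (G.degree v - d) + s ^ 2 * (G.degree w - d) +
      2 * s * (if G.Adj v w then 1 else 0))
    (hb : ((if G.Adj u v then 1 else 0) - s * (if G.Adj u w then 1 else 0)) ^ 2 ≤
      (G.degree u - d) * ((G.degree v - d) + s ^ 2 * (G.degree w - d) +
      2 * s * (if G.Adj v w then 1 else 0))) :
    d ≤ (G.isHermitian_lapMatrix ℝ).eigenvalues₀ ⟨1, h⟩ := by
  refine (G.isHermitian_lapMatrix ℝ).le_eigenvalues₀_one h (x := Pi.single u 1)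
    (y := Pi.single v 1 - Pi.single w s) (fun α β h0 => ?_) fun α β => ?_
  · have h1 := congrFun h0 u
    have h2 := congrFun h0 v
    simp [huv, huv.symm, huw, hvw] at h1 h2
    exact ⟨h1, h2⟩
  · have key := quadratic_nonneg_of_sq_le_mul (sub_nonneg.2 hu) hc
      ((neg_sq _).trans_le hb) α β
    simp only [smul_sub, ← Pi.single_smul, smul_eq_mul, mul_one, mulVec_add, mulVec_sub,
      dotProduct_add, add_dotProduct, dotProduct_sub, sub_dotProduct,
      single_dotProduct_lapMatrix_mulVec_single, lapMatrix_apply_self,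
      lapMatrix_apply_of_ne G huv, lapMatrix_apply_of_ne G huv.symm,
      lapMatrix_apply_of_ne G huw, lapMatrix_apply_of_ne G huw.symm,
      lapMatrix_apply_of_ne G hvw, lapMatrix_apply_of_ne G hvw.symm,
      G.adj_comm v u, G.adj_comm w u, G.adj_comm w v]
    simp only [single_dotProduct, Pi.single_eq_same, Pi.single_eq_of_ne huv, Pi.single_eq_of_ne huv.symm,
      Pi.single_eq_of_ne huw, Pi.single_eq_of_ne huw.symm,
      Pi.single_eq_of_ne hvw, Pi.single_eq_of_ne hvw.symm]
    linarith

/-- The form is a sum over all edges; only those meeting {u, v} are kept. -/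
lemma sum_sq_le_lapMatrix_form {u v : V} (h : G.Adj u v) (z : V → ℝ) :
    (z u - z v) ^ 2 + ∑ w ∈ (G.neighborFinset u).erase v, (z u - z w) ^ 2 +
      ∑ w ∈ (G.neighborFinset v).erase u, (z v - z w) ^ 2 ≤ z ⬝ᵥ G.lapMatrix ℝ *ᵥ z := by
  have hform := SimpleGraph.lapMatrix_toLinearMap₂' ℝ G z
  rw [toLinearMap₂'_apply'] at hform
  rw [hform]
  have hu : v ∈ G.neighborFinset u := by simpa using h
  have hv : u ∈ G.neighborFinset v := by simpa using h.symm
  have e : ∀ a, ∑ b, (if G.Adj a b then (z a - z b) ^ 2 else 0) =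
      ∑ b ∈ G.neighborFinset a, (z a - z b) ^ 2 := by
    intro a
    rw [← Finset.sum_filter]
    congr 1
    ext; simp
  -- The form is half a sum over ordered pairs. Rows outside {u, v} supply the second copy of each
  -- edge leaving {u, v}.
  have hrest : ∑ w ∈ (G.neighborFinset u).erase v, (z u - z w) ^ 2 +
      ∑ w ∈ (G.neighborFinset v).erase u, (z v - z w) ^ 2 ≤
      ∑ w ∈ (Finset.univ.erase u).erase v, ∑ b, (if G.Adj w b then (z w - z b) ^ 2 else 0) := by
    have e1 : ∑ w ∈ (G.neighborFinset u).erase v, (z u - z w) ^ 2 =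
        ∑ w ∈ (Finset.univ.erase u).erase v, if G.Adj u w then (z u - z w) ^ 2 else 0 := by
      rw [← Finset.sum_filter]
      congr 1
      ext w
      simp only [Finset.mem_erase, SimpleGraph.mem_neighborFinset, Finset.mem_filter,
        Finset.mem_univ, and_true]
      exact ⟨fun h => ⟨⟨h.1, h.2.ne'⟩, h.2⟩, fun h => ⟨h.1.1, h.2⟩⟩
    have e2 : ∑ w ∈ (G.neighborFinset v).erase u, (z v - z w) ^ 2 =
        ∑ w ∈ (Finset.univ.erase u).erase v, if G.Adj v w then (z v - z w) ^ 2 else 0 := by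
      rw [← Finset.sum_filter]
      congr 1
      ext w
      simp only [Finset.mem_erase, SimpleGraph.mem_neighborFinset, Finset.mem_filter,
        Finset.mem_univ, and_true]
      exact ⟨fun h => ⟨⟨h.2.ne', h.1⟩, h.2⟩, fun h => ⟨h.1.2, h.2⟩⟩
    rw [e1, e2, ← Finset.sum_add_distrib]
    refine Finset.sum_le_sum fun w _ => ?_
    have hnn : ∀ b ∈ Finset.univ, 0 ≤ (if G.Adj w b then (z w - z b) ^ 2 else 0) :=
      fun b _ => by positivity
    have := Finset.sum_le_sum_of_subset_of_nonneg (Finset.subset_univ {u, v})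
      fun b hb _ => hnn b hb
    rw [Finset.sum_pair h.ne] at this
    refine le_trans (le_of_eq ?_) this
    simp only [G.adj_comm w u, G.adj_comm w v, sub_sq_comm (z w)]
  rw [← Finset.add_sum_erase _ _ (Finset.mem_univ u),
    ← Finset.add_sum_erase _ _ (Finset.mem_erase.2 ⟨h.ne', Finset.mem_univ v⟩), e u, e v,
    ← Finset.add_sum_erase _ _ hu, ← Finset.add_sum_erase _ _ hv, sub_sq_comm (z v) (z u)]
  linarith

/-- The second largest Laplacian eigenvalue is at least the smaller of two degrees. -/
lemma degree_le_eigenvalues₀_one (h : 1 < Fintype.card V) {u v : V} (hadj : G.Adj u v)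
    (hle : G.degree v ≤ G.degree u) (h2 : 2 ≤ G.degree v) :
    (G.degree v : ℝ) ≤ (G.isHermitian_lapMatrix ℝ).eigenvalues₀ ⟨1, h⟩ := by
  have hcu : ((G.neighborFinset u).erase v).card = G.degree u - 1 := by
    rw [Finset.card_erase_of_mem (by simpa using hadj), G.card_neighborFinset_eq_degree]
  have hcv : ((G.neighborFinset v).erase u).card = G.degree v - 1 := by
    rw [Finset.card_erase_of_mem (by simpa using hadj.symm), G.card_neighborFinset_eq_degree]
  -- T is cut down to N = deg v − 1 vertices, matching R in size, so that the cross terms in α and β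
  -- cancel. T and R may overlap, which only lowers the norm.
  obtain ⟨T, hT, hTc⟩ := Finset.exists_subset_card_eq
    (show G.degree v - 1 ≤ ((G.neighborFinset u).erase v).card by omega)
  set R := (G.neighborFinset v).erase u with hR
  obtain ⟨N, hN⟩ : ∃ N, G.degree v = N + 1 := ⟨G.degree v - 1, by omega⟩
  rw [hN, Nat.add_sub_cancel] at hTc hcv
  have hN1 : 1 ≤ N := by omega
  have hNpos : (0 : ℝ) < N := by exact_mod_cast hN1
  have huS : u ∉ T ∪ R := by
    simp only [Finset.mem_union, not_or]
    exact ⟨fun h => by simpa using hT h, by simp [hR]⟩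
  have hvS : v ∉ T ∪ R := by
    simp only [Finset.mem_union, not_or]
    exact ⟨fun h => by simpa using hT h, by simp [hR]⟩
  have hScard : ((T ∪ R).card : ℝ) ≤ 2 * N := by
    have := Finset.card_union_le T R
    have : (T ∪ R).card ≤ 2 * N := by omega
    exact_mod_cast this
  -- The weight −1/N maximizes N(1 + t)² / (1 + N t²) at t = 1/N, with maximum N + 1 = deg v.
  let f : V → ℝ := fun w => if w ∈ T ∪ R then -(1 / N : ℝ) else 0
  have hfu : f u = 0 := if_neg huS
  have hfv : f v = 0 := if_neg hvS
  refine (G.isHermitian_lapMatrix ℝ).le_eigenvalues₀_one h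
    (x := Pi.single u 1 + Pi.single v 1 + f)
    (y := Pi.single u 1 - Pi.single v 1) (fun α β h0 => ?_) fun α β => ?_
  · have h1 := congrFun h0 u
    have h2 := congrFun h0 v
    simp [hadj.ne, hadj.ne', hfu, hfv] at h1 h2
    constructor <;> linarith
  · set z := α • (Pi.single u 1 + Pi.single v 1 + f) +
      β • ((Pi.single u 1 : V → ℝ) - Pi.single v 1) with hz
    have hzu : z u = α + β := by simp [hz, hfu, hadj.ne]
    have hzv : z v = α - β := by simp [hz, hfv, hadj.ne', sub_eq_add_neg]
    have hzS : ∀ w ∈ T ∪ R, z w = -(α / N) := by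
      intro w hw
      have hwu : w ≠ u := fun h => huS (h ▸ hw)
      have hwv : w ≠ v := fun h => hvS (h ▸ hw)
      simp only [hz, f, Pi.add_apply, Pi.smul_apply, Pi.sub_apply, Pi.single_eq_of_ne hwu,
        Pi.single_eq_of_ne hwv, hw, if_true, smul_eq_mul]
      ring
    have hz0 : ∀ w, w ∉ insert u (insert v (T ∪ R)) → z w = 0 := by
      intro w hw
      rw [Finset.mem_insert, Finset.mem_insert, not_or, not_or] at hw
      simp only [hz, f, Pi.add_apply, Pi.smul_apply, Pi.sub_apply, Pi.single_eq_of_ne hw.1,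
        Pi.single_eq_of_ne hw.2.1, hw.2.2, if_false, smul_eq_mul]
      ring
    have hnorm : z ⬝ᵥ z ≤ (α + β) ^ 2 + (α - β) ^ 2 + 2 * N * (α / N) ^ 2 := by
      have : z ⬝ᵥ z = ∑ w ∈ insert u (insert v (T ∪ R)), z w ^ 2 := by
        rw [dotProduct, ← Finset.sum_subset (Finset.subset_univ (insert u (insert v (T ∪ R))))
          fun w _ hw => by rw [hz0 w hw, zero_mul]]
        exact Finset.sum_congr rfl fun w _ => (sq _).symm
      rw [this, Finset.sum_insert, Finset.sum_insert hvS, hzu, hzv,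
        Finset.sum_congr rfl fun w hw => by rw [hzS w hw, neg_sq], Finset.sum_const, nsmul_eq_mul]
      · have := mul_le_mul_of_nonneg_right hScard (sq_nonneg (α / N))
        linarith
      · rw [Finset.mem_insert, not_or]
        exact ⟨hadj.ne, huS⟩
    have hform := sum_sq_le_lapMatrix_form hadj z
    have hTsum : N * (α + β + α / N) ^ 2 ≤
        ∑ w ∈ (G.neighborFinset u).erase v, (z u - z w) ^ 2 := by
      refine le_trans (le_of_eq ?_)
        (Finset.sum_le_sum_of_subset_of_nonneg hT fun _ _ _ => sq_nonneg _)
      rw [Finset.sum_congr rfl fun w hw => by rw [hzu, hzS w (Finset.mem_union_left _ hw)],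
        Finset.sum_const, nsmul_eq_mul, hTc]
      ring
    have hRsum : N * (α - β + α / N) ^ 2 ≤ ∑ w ∈ R, (z v - z w) ^ 2 := by
      rw [Finset.sum_congr rfl fun w hw => by rw [hzv, hzS w (Finset.mem_union_right _ hw)],
        Finset.sum_const, nsmul_eq_mul, hcv]
      exact le_of_eq (by ring)
    rw [hzv] at hRsum
    rw [hzu] at hTsum
    rw [hzu, hzv] at hform
    rw [hN]
    have hb := mul_le_mul_of_nonneg_left hnorm (show (0 : ℝ) ≤ ((N + 1 : ℕ) : ℝ) by positivity)
    -- The lower bound for the form exceeds N + 1 times the norm bound by exactly 2β².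
    have hgap : ((N + 1 : ℕ) : ℝ) * ((α + β) ^ 2 + (α - β) ^ 2 + 2 * N * (α / N) ^ 2) +
        2 * β ^ 2 = (α + β - (α - β)) ^ 2 + N * (α + β + α / N) ^ 2 +
          N * (α - β + α / N) ^ 2 := by
      push_cast
      field_simp
      ring
    linarith [sq_nonneg β]

end Laplacian

/-! ### All edges share a vertex when μ_2 is below the average degree -/

section LargestDegree

variable {V : Type*} [Fintype V] [DecidableEq V] {G : SimpleGraph V} [DecidableRel G.Adj]

/-- In use, ε = d − k, E = deg u − d, F is the total deficiency, g that of w, and p counts the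
neighbours of u of degree k. The conclusion is the determinant condition E(1/(ε + g) − ε) ≥ 1. It
follows from p(ε + g) ≤ pε + F, where pε + F is at most both E and n, and from nε + 1 ≤ p. -/
lemma degree_deficiency_inequality {n p k F g ε E : ℝ} (hp : n * ε + k ≤ p) (hk : 1 ≤ k)
    (hpn : p ≤ n - 1) (hε : 0 < ε) (hpg : p * g ≤ F)
    (hΔ : n * ε + F + k ≤ n - 1) (hE : E = (n - 1) * ε + F) (hE0 : 0 < E) (hn : 0 < n) :
    (ε + g) * (ε * E + 1) ≤ E := by
  have hnε : 0 < n * ε := mul_pos hn hε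
  have hp0 : 0 < p := by linarith
  have h1 : p * (ε + g) ≤ p * ε + F := by linarith
  have hpε : p * ε ≤ (n - 1) * ε := mul_le_mul_of_nonneg_right hpn hε.le
  have h2 : p * ε + F ≤ E := by linarith
  have h3 : p * ε + F ≤ n := by linarith
  have h4 : (p * ε + F) * (ε * E) ≤ n * (ε * E) :=
    mul_le_mul_of_nonneg_right h3 (mul_pos hε hE0).le
  have h5 : p * (ε + g) * (ε * E + 1) ≤ (p * ε + F) * (ε * E + 1) :=
    mul_le_mul_of_nonneg_right h1 (by positivity)
  have h6 : (n * ε + 1) * E ≤ p * E := mul_le_mul_of_nonneg_right (by linarith) hE0.le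
  refine le_of_mul_le_mul_left ?_ hp0
  linarith

/-- If all vertices other than `u` have degree at most `k`, then some edge avoiding `u` joins a
neighbour of `u` of degree `k` to a vertex whose deficiency `k - deg w` is at most average. -/
lemma exists_edge_of_small_deficiency {u : V} {k : ℕ} (hk : 2 ≤ k)
    (hdeg : ∀ v, v ≠ u → G.degree v ≤ k)
    (hD : ((G.neighborFinset u).filter (fun v => G.degree v = k)).Nonempty) :
    ∃ v w, G.Adj u v ∧ G.degree v = k ∧ G.Adj v w ∧ w ≠ u ∧
      (((G.neighborFinset u).filter (fun v => G.degree v = k)).card : ℝ) * (k - G.degree w) ≤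
        ∑ w ∈ Finset.univ.erase u, ((k : ℝ) - G.degree w) := by
  set D := (G.neighborFinset u).filter (fun v => G.degree v = k)
  set F := ∑ w ∈ Finset.univ.erase u, ((k : ℝ) - G.degree w) with hF
  by_contra! hcon
  have hmem : ∀ v ∈ D, G.Adj u v ∧ G.degree v = k := fun v hv => by simpa [D] using hv
  have hcard : ∀ v ∈ D, ((G.neighborFinset v).erase u).card = k - 1 := fun v hv => by
    rw [Finset.card_erase_of_mem (by simpa using (hmem v hv).1.symm),
      G.card_neighborFinset_eq_degree, (hmem v hv).2]
  have hswap : ∑ v ∈ D, ∑ w ∈ (G.neighborFinset v).erase u, ((k : ℝ) - G.degree w) =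
      ∑ w ∈ Finset.univ.erase u, ∑ v ∈ D.filter (fun v => G.Adj v w), ((k : ℝ) - G.degree w) := by
    refine Finset.sum_comm' fun v w => ?_
    simp only [Finset.mem_erase, SimpleGraph.mem_neighborFinset, Finset.mem_filter,
      Finset.mem_univ, and_true]
    tauto
  -- A vertex w is counted at most deg w times, and deg w ≤ k − 1 unless its deficiency vanishes.
  have hub : ∑ v ∈ D, ∑ w ∈ (G.neighborFinset v).erase u, ((k : ℝ) - G.degree w) ≤
      ((k - 1 : ℕ) : ℝ) * F := by
    rw [hswap, hF, Finset.mul_sum]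
    refine Finset.sum_le_sum fun w hw => ?_
    have hwk := hdeg w (Finset.ne_of_mem_erase hw)
    rw [Finset.sum_const, nsmul_eq_mul]
    rcases hwk.eq_or_lt with h | h
    · simp [h]
    · refine mul_le_mul_of_nonneg_right ?_ (sub_nonneg.2 (by exact_mod_cast hwk))
      have : (D.filter (fun v => G.Adj v w)).card ≤ (G.neighborFinset w).card :=
        Finset.card_le_card fun v hv => by simpa using (Finset.mem_filter.1 hv).2.symm
      rw [G.card_neighborFinset_eq_degree] at this
      exact_mod_cast (by omega : _ ≤ k - 1)
  have hDpos : (0 : ℝ) < D.card := by exact_mod_cast hD.card_pos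
  have hlb : ∑ v ∈ D, ∑ w ∈ (G.neighborFinset v).erase u, (F / D.card) <
      ∑ v ∈ D, ∑ w ∈ (G.neighborFinset v).erase u, ((k : ℝ) - G.degree w) := by
    refine Finset.sum_lt_sum_of_nonempty hD fun v hv => ?_
    refine Finset.sum_lt_sum_of_nonempty ?_ fun w hw => ?_
    · rw [← Finset.card_pos, hcard v hv]
      omega
    · rw [div_lt_iff₀ hDpos, mul_comm]
      exact hcon v w (hmem v hv).1 (hmem v hv).2
        (by simpa using Finset.mem_of_mem_erase hw) (Finset.ne_of_mem_erase hw)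
  have heq : ∑ v ∈ D, ∑ w ∈ (G.neighborFinset v).erase u, (F / D.card) =
      ((k - 1 : ℕ) : ℝ) * F := by
    rw [Finset.sum_congr rfl fun v hv => by rw [Finset.sum_const, hcard v hv],
      Finset.sum_const, nsmul_eq_mul, nsmul_eq_mul]
    field_simp
  linarith

/-- If all vertices but one have degree at most `k`, where `2 ≤ k` and `k` is less than the average
degree, then the second largest Laplacian eigenvalue is at least the average degree. -/
lemma avgDegree_le_eigenvalues₀_one_of_degree_le (h : 1 < Fintype.card V) {u : V} {k : ℕ}
    (hk : 2 ≤ k) (hkd : (k : ℝ) < avgDegree G) (hdeg : ∀ v, v ≠ u → G.degree v ≤ k) :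
    avgDegree G ≤ (G.isHermitian_lapMatrix ℝ).eigenvalues₀ ⟨1, h⟩ := by
  have : Nonempty V := ⟨u⟩
  have hn : (0 : ℝ) < Fintype.card V := by exact_mod_cast (by omega : 0 < Fintype.card V)
  set n : ℝ := (Fintype.card V : ℝ) with hndef
  obtain ⟨ε, hε⟩ : ∃ ε, ε = avgDegree G - k := ⟨_, rfl⟩
  have hε0 : 0 < ε := by linarith
  set D := (G.neighborFinset u).filter (fun v => G.degree v = k) with hD
  set F := ∑ w ∈ Finset.univ.erase u, ((k : ℝ) - G.degree w) with hF
  have hterm : ∀ w ∈ Finset.univ.erase u, 0 ≤ (k : ℝ) - G.degree w := fun w hw =>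
    sub_nonneg.2 (by exact_mod_cast hdeg w (Finset.ne_of_mem_erase hw))
  have hcard : (((Finset.univ : Finset V).erase u).card : ℝ) = n - 1 := by
    rw [Finset.card_erase_of_mem (Finset.mem_univ u), Finset.card_univ, Nat.cast_sub h.le]
    simp [hndef]
  have hsum : n * ε = G.degree u - k - F := by
    have h1 := avgDegree_mul_card G
    rw [← Finset.add_sum_erase _ _ (Finset.mem_univ u)] at h1
    rw [hF, Finset.sum_sub_distrib, Finset.sum_const, nsmul_eq_mul, hcard, hε]
    linarith
  have hΔ : (G.degree u : ℝ) ≤ n - 1 := by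
    have : G.degree u + 1 ≤ Fintype.card V := G.degree_lt_card_verts u
    have : (G.degree u : ℝ) + 1 ≤ n := by rw [hndef]; exact_mod_cast this
    linarith
  have hDle : (D.card : ℝ) ≤ G.degree u := by
    rw [← G.card_neighborFinset_eq_degree]
    exact_mod_cast Finset.card_filter_le _ _
  -- Each neighbour of u of degree below k adds at least 1 to F.
  have hp : n * ε + k ≤ D.card := by
    have h1 := Finset.card_filter_add_card_filter_not (s := G.neighborFinset u)
      (fun v => G.degree v = k)
    rw [G.card_neighborFinset_eq_degree] at h1
    have h2 : (((G.neighborFinset u).filter (fun v => ¬ G.degree v = k)).card : ℝ) ≤ F := by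
      rw [Finset.card_eq_sum_ones, Nat.cast_sum]
      have hsub : (G.neighborFinset u).filter (fun v => ¬ G.degree v = k) ⊆
          Finset.univ.erase u := fun w hw => by
        have := (Finset.mem_filter.1 hw).1
        rw [SimpleGraph.mem_neighborFinset] at this
        simpa using this.ne'
      refine le_trans (Finset.sum_le_sum fun w hw => ?_)
        (Finset.sum_le_sum_of_subset_of_nonneg hsub fun w hw _ => hterm w hw)
      have h3 := hdeg w (Finset.ne_of_mem_erase (hsub hw))
      have h4 := (Finset.mem_filter.1 hw).2
      have h5 : G.degree w + 1 ≤ k := by omega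
      have h6 : (G.degree w : ℝ) + 1 ≤ k := by exact_mod_cast h5
      push_cast
      linarith
    have h3 : (D.card : ℝ) +
        ((G.neighborFinset u).filter (fun v => ¬ G.degree v = k)).card = G.degree u := by
      exact_mod_cast h1
    linarith
  have hk2 : (2 : ℝ) ≤ k := by exact_mod_cast hk
  have hnε : 0 < n * ε := mul_pos hn hε0
  have hDne : D.Nonempty := by
    rw [← Finset.card_pos]
    exact_mod_cast (by linarith : (0 : ℝ) < D.card)
  obtain ⟨v, w, huv, hvk, hvw, hwu, hg⟩ := exists_edge_of_small_deficiency hk hdeg hDne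
  have hFnn : 0 ≤ F := Finset.sum_nonneg hterm
  have hlt : ε < n * ε := by
    refine lt_mul_of_one_lt_left hε0 ?_
    rw [hndef]
    exact_mod_cast h
  obtain ⟨g, hgdef⟩ : ∃ g : ℝ, g = k - G.degree w := ⟨_, rfl⟩
  have hg0 : 0 ≤ g := hgdef ▸ hterm w (by simp [hwu])
  obtain ⟨E, hE⟩ : ∃ E, E = G.degree u - avgDegree G := ⟨_, rfl⟩
  have hE' : E = (n - 1) * ε + F := by linarith
  have hE0 : 0 < E := by linarith
  have hineq := degree_deficiency_inequality hp (by linarith) (by linarith) hε0 (g := g)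
    (by rw [hgdef]; exact hg) (by linarith) hE' hE0 hn
  have hεg : 0 < ε + g := by linarith
  have hform : ∀ s : ℝ, ((k : ℝ) - avgDegree G) + s ^ 2 * (G.degree w - avgDegree G) +
      2 * s * 1 = 2 * s - ε - s ^ 2 * (ε + g) := fun s => by rw [hε, hgdef]; ring
  have hu : avgDegree G ≤ G.degree u := by linarith
  -- This s maximizes 2s − ε − s²(ε + g), with value s − ε.
  set s := 1 / (ε + g) with hs
  have hs0 : 0 < s := by positivity
  have hsval : 2 * s - ε - s ^ 2 * (ε + g) = s - ε := by
    rw [hs]; field_simp; ring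
  have hsE : 1 ≤ E * (s - ε) := by
    rw [mul_sub, hs, mul_one_div, le_sub_iff_add_le, le_div_iff₀ hεg]
    linarith
  have hsε : 0 ≤ s - ε := nonneg_of_mul_nonneg_right (by linarith) hE0
  by_cases huw : G.Adj u w
  · by_cases hgw : G.degree w = k
    · have hg00 : g = 0 := by rw [hgdef, hgw, sub_self]
      have hε1 : ε ≤ 1 := by
        have : n * ε ≤ n * 1 := by linarith
        exact le_of_mul_le_mul_left this hn
      refine le_eigenvalues₀_one_of_three_vertices (s := 1) h huv.ne hwu.symm hvw.ne hu ?_ ?_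
      · rw [if_pos hvw, hvk, hform]
        linarith
      · rw [if_pos hvw, if_pos huv, if_pos huw, hvk, hform, ← hE, hg00]
        have := mul_nonneg hE0.le (sub_nonneg.2 hε1)
        linarith
    · have hg1 : 1 ≤ g := by
        have := hdeg w hwu
        have h5 : G.degree w + 1 ≤ k := by omega
        have h6 : (G.degree w : ℝ) + 1 ≤ k := by exact_mod_cast h5
        linarith
      have hs1 : s ≤ 1 := by
        rw [hs, div_le_one hεg]
        linarith
      refine le_eigenvalues₀_one_of_three_vertices (s := s) h huv.ne hwu.symm hvw.ne hu ?_ ?_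
      · rw [if_pos hvw, hvk, hform, hsval]
        exact hsε
      · rw [if_pos hvw, if_pos huv, if_pos huw, hvk, hform, hsval, ← hE]
        refine le_trans ?_ hsE
        rw [mul_one, sq_le_one_iff_abs_le_one, abs_le]
        constructor <;> linarith
  · refine le_eigenvalues₀_one_of_three_vertices (s := s) h huv.ne hwu.symm hvw.ne hu ?_ ?_
    · rw [if_pos hvw, hvk, hform, hsval]
      exact hsε
    · rw [if_pos hvw, if_pos huv, if_neg huw, hvk, hform, hsval, ← hE]
      simpa using hsE

/-- If the second largest Laplacian eigenvalue is less than the average degree, then all edges share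
a vertex. -/
lemma exists_center_of_eigenvalues₀_one_lt (h : 1 < Fintype.card V)
    (hlt : (G.isHermitian_lapMatrix ℝ).eigenvalues₀ ⟨1, h⟩ < avgDegree G) :
    ∃ u, ∀ v w, G.Adj v w → v = u ∨ w = u := by
  have : Nonempty V := Fintype.card_pos_iff.1 (by omega)
  by_cases htwo : ∃ u v, u ≠ v ∧ avgDegree G ≤ G.degree u ∧ avgDegree G ≤ G.degree v
  · obtain ⟨u, v, huv, hu, hv, hle⟩ : ∃ u v, u ≠ v ∧ avgDegree G ≤ G.degree u ∧
        avgDegree G ≤ G.degree v ∧ G.degree v ≤ G.degree u := by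
      obtain ⟨u, v, huv, hu, hv⟩ := htwo
      rcases le_total (G.degree v) (G.degree u) with hle | hle
      · exact ⟨u, v, huv, hu, hv, hle⟩
      · exact ⟨v, u, huv.symm, hv, hu, hle⟩
    have hclique : ∀ a b, a ≠ b → avgDegree G ≤ G.degree a → avgDegree G ≤ G.degree b →
        G.Adj a b := fun a b hab ha hb => by
      by_contra hadj
      exact hlt.not_ge (le_eigenvalues₀_one_of_not_adj h hab hadj ha hb)
    have hadj := hclique u v huv hu hv
    have hv1 : G.degree v < 2 := by
      by_contra! h2
      exact hlt.not_ge (hv.trans (degree_le_eigenvalues₀_one h hadj hle h2))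
    have hd1 : avgDegree G ≤ 1 := hv.trans (by exact_mod_cast (by omega : G.degree v ≤ 1))
    have honly : ∀ a, G.Adj v a → a = u := by
      intro a ha
      rw [← G.card_neighborFinset_eq_degree] at hv1
      exact Finset.card_le_one.1 (by omega : (G.neighborFinset v).card ≤ 1) a (by simpa using ha)
        u (by simpa using hadj.symm)
    -- As d ≤ 1, every non-isolated vertex reaches the threshold, so it is v or adjacent to v, whose
    -- only neighbour is u.
    have hmem : ∀ a b, G.Adj a b → a = u ∨ a = v := by
      intro a b hab
      by_contra! hne
      have ha : 1 ≤ G.degree a := (G.degree_pos_iff_exists_adj a).2 ⟨b, hab⟩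
      exact hne.1 (honly a (hclique v a hne.2.symm hv (hd1.trans (by exact_mod_cast ha))))
    refine ⟨u, fun a b hab => ?_⟩
    rcases hmem a b hab with rfl | rfl
    · exact Or.inl rfl
    · exact Or.inr (honly b hab)
  · push Not at htwo
    obtain ⟨u, hu⟩ := exists_avgDegree_le_degree G
    have hlow : ∀ v, v ≠ u → (G.degree v : ℝ) < avgDegree G := fun v hv =>
      htwo u v hv.symm hu
    obtain ⟨a, ha⟩ := Fintype.exists_ne_of_one_lt_card h u
    obtain ⟨v, hv, hmax⟩ := Finset.exists_max_image (Finset.univ.erase u) (fun w => G.degree w)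
      ⟨a, by simp [ha]⟩
    have hvu := Finset.ne_of_mem_erase hv
    have hmax' : ∀ w, w ≠ u → G.degree w ≤ G.degree v := fun w hw => hmax w (by simp [hw])
    have hk : G.degree v < 2 := by
      by_contra! h2
      exact hlt.not_ge (avgDegree_le_eigenvalues₀_one_of_degree_le h h2 (hlow v hvu) hmax')
    refine ⟨u, fun b c hbc => ?_⟩
    by_contra! hne
    have honly : ∀ b c, b ≠ u → c ≠ u → G.Adj b c → ¬ G.Adj u b := by
      intro b c hb hc hbc hub
      have h1 := hmax' b hb
      rw [← G.card_neighborFinset_eq_degree] at h1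
      exact hc (Finset.card_le_one.1 (by omega : (G.neighborFinset b).card ≤ 1) c
        (by simpa using hbc) u (by simpa using hub.symm))
    have hb1 : 1 ≤ G.degree b := (G.degree_pos_iff_exists_adj b).2 ⟨c, hbc⟩
    have hc1 : 1 ≤ G.degree c := (G.degree_pos_iff_exists_adj c).2 ⟨b, hbc.symm⟩
    have hbe : G.degree b = 1 := by have := hmax' b hne.1; omega
    have hce : G.degree c = 1 := by have := hmax' c hne.2; omega
    have hd2 : avgDegree G ≤ 2 := by
      have hn : (0 : ℝ) < Fintype.card V := by exact_mod_cast (by omega : 0 < Fintype.card V)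
      refine le_of_mul_le_mul_right ?_ hn
      rw [avgDegree_mul_card, ← Finset.add_sum_erase _ _ (Finset.mem_univ u)]
      have h1 : ∑ w ∈ Finset.univ.erase u, (G.degree w : ℝ) ≤
          ∑ w ∈ Finset.univ.erase u, (1 : ℝ) := Finset.sum_le_sum fun w hw => by
        have := hmax' w (Finset.ne_of_mem_erase hw)
        exact_mod_cast (by omega : G.degree w ≤ 1)
      have h2 : (G.degree u : ℝ) ≤ Fintype.card V := by
        exact_mod_cast (G.degree_lt_card_verts u).le
      have h3 : ∑ w ∈ Finset.univ.erase u, (1 : ℝ) ≤ Fintype.card V := by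
        rw [Finset.sum_const, nsmul_eq_mul, mul_one]
        exact_mod_cast Finset.card_le_univ _
      linarith
    -- The edge bc is a component, so e_b − e_c has Rayleigh quotient 2 ≥ d and no cross term with
    -- e_u.
    refine hlt.not_ge (le_eigenvalues₀_one_of_three_vertices (s := 1) h hne.1.symm hne.2.symm
      hbc.ne hu ?_ ?_)
    · rw [if_pos hbc, hbe, hce]
      push_cast
      linarith
    · rw [if_pos hbc, if_neg (honly b c hne.1 hne.2 hbc),
        if_neg (honly c b hne.2 hne.1 hbc.symm), hbe, hce]
      have := mul_nonneg (sub_nonneg.2 hu) (sub_nonneg.2 hd2)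
      push_cast
      linarith

end LargestDegree

/-! ### Stars with isolated vertices -/

section Star

variable {V : Type*} [Fintype V] {G : SimpleGraph V} [DecidableRel G.Adj]

lemma nonempty_iso_starWithIsolated [DecidableEq V] {u : V}
    (hu : ∀ v w, G.Adj v w → v = u ∨ w = u) :
    Nonempty (G ≃g starWithIsolated (G.degree u) (Fintype.card V - 1 - G.degree u)) := by
  have hlt := G.degree_lt_card_verts u
  set I : Finset V := Finset.univ \ insert u (G.neighborFinset u) with hI
  have hIcard : I.card = Fintype.card V - 1 - G.degree u := by
    rw [hI, Finset.card_univ_sdiff, Finset.card_insert_of_notMem (by simp),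
      G.card_neighborFinset_eq_degree]
    omega
  let e := (G.neighborFinset u).equivFinOfCardEq (G.card_neighborFinset_eq_degree u)
  let e' := I.equivFinOfCardEq hIcard
  let g : (Fin 1 ⊕ Fin (G.degree u)) ⊕ Fin (Fintype.card V - 1 - G.degree u) → V :=
    Sum.elim (Sum.elim (fun _ => u) fun i => e.symm i) fun i => e'.symm i
  have he : ∀ i, G.Adj u (e.symm i) := fun i =>
    (G.mem_neighborFinset u _).1 (e.symm i).2
  have he' : ∀ i, (e'.symm i : V) ≠ u ∧ ¬ G.Adj u (e'.symm i) := fun i => by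
    have h : ∀ a ∈ I, a ≠ u ∧ ¬ G.Adj u a := fun a ha => by simpa [hI] using ha
    exact h _ (e'.symm i).2
  have hinj : Function.Injective g := by
    refine Function.Injective.sumElim (Function.Injective.sumElim
      (fun _ _ _ => Subsingleton.elim _ _) (Subtype.val_injective.comp e.symm.injective)
      fun _ i => (he i).ne) (Subtype.val_injective.comp e'.symm.injective) ?_
    rintro (a | i) j
    · exact (he' j).1.symm
    · intro h
      exact (he' j).2 (by rw [← h]; exact he i)
  have hbij : Function.Bijective g := by
    rw [Fintype.bijective_iff_injective_and_card]
    refine ⟨hinj, ?_⟩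
    simp
    omega
  refine ⟨RelIso.symm ⟨Equiv.ofBijective g hbij, fun {a b} => ?_⟩⟩
  have hnot : ∀ v w, v ≠ u → w ≠ u → ¬ G.Adj v w := fun v w hv hw h => (hu v w h).elim hv hw
  rcases a with (a | a) | a <;> rcases b with (b | b) | b <;>
    simp only [Equiv.ofBijective_apply, g, Sum.elim_inl, Sum.elim_inr, starWithIsolated,
      SimpleGraph.sum_adj, completeBipartiteGraph_adj]
  · simp
  · simpa using he b
  · simpa using (he' b).2
  · simpa using (he a).symm
  · simpa using hnot _ _ (he a).ne' (he b).ne'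
  · simpa using hnot _ _ (he a).ne' (he' b).1
  · simpa using fun h : G.Adj _ _ => (he' a).2 h.symm
  · simpa using hnot _ _ (he' a).1 (he b).ne'
  · simpa using hnot _ _ (he' a).1 (he' b).1

lemma exists_center_of_iso {s r : ℕ}
    (f : G ≃g starWithIsolated s r) :
    ∃ u, (∀ v w, G.Adj v w → v = u ∨ w = u) ∧ G.degree u = s := by
  set u := f.symm (.inl (.inl 0)) with hu
  have hfu : f u = .inl (.inl 0) := f.apply_symm_apply _
  refine ⟨u, fun v w h => ?_, ?_⟩
  · rw [← f.map_adj_iff] at h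
    have key : ∀ a b, (starWithIsolated s r).Adj a b → a = .inl (.inl 0) ∨ b = .inl (.inl 0) := by
      rintro ((a | a) | a) ((b | b) | b) h <;>
        simp_all [starWithIsolated, Subsingleton.elim _ (0 : Fin 1)]
    rcases key _ _ h with h | h
    · exact Or.inl (f.injective (h.trans hfu.symm))
    · exact Or.inr (f.injective (h.trans hfu.symm))
  · let g : Fin s ↪ V := ⟨fun i => f.symm (.inl (.inr i)),
      fun i j h => by simpa using f.symm.injective h⟩
    have : G.neighborFinset u = Finset.univ.map g := by
      ext w
      rw [SimpleGraph.mem_neighborFinset, ← f.map_adj_iff, hfu]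
      simp only [Finset.mem_map, Finset.mem_univ, true_and]
      constructor
      · intro h
        rcases hw : f w with (b | b) | b
        · rw [hw] at h
          simp [starWithIsolated] at h
        · exact ⟨b, by rw [← f.symm_apply_apply w, hw]; rfl⟩
        · rw [hw] at h
          simp [starWithIsolated] at h
      · rintro ⟨i, rfl⟩
        have : f (g i) = .inl (.inr i) := f.apply_symm_apply _
        rw [this]
        simp [starWithIsolated]
    rw [← G.card_neighborFinset_eq_degree, this, Finset.card_map, Finset.card_univ,
      Fintype.card_fin]

lemma degree_eq_ite_of_center {u : V} (hu : ∀ v w, G.Adj v w → v = u ∨ w = u) {w : V}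
    (hw : w ≠ u) : G.degree w = if G.Adj u w then 1 else 0 := by
  have : G.neighborFinset w = if G.Adj u w then {u} else ∅ := by
    ext a
    rw [SimpleGraph.mem_neighborFinset]
    split_ifs with h
    · rw [Finset.mem_singleton]
      exact ⟨fun ha => (hu w a ha).resolve_left hw, fun ha => ha ▸ h.symm⟩
    · simp only [Finset.notMem_empty, iff_false]
      intro ha
      obtain rfl := (hu w a ha).resolve_left hw
      exact h ha.symm
  rw [← G.card_neighborFinset_eq_degree, this]
  split_ifs <;> simp

variable [DecidableEq V]

lemma avgDegree_mul_card_of_center {u : V} (hu : ∀ v w, G.Adj v w → v = u ∨ w = u) :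
    avgDegree G * Fintype.card V = 2 * G.degree u := by
  have : Nonempty V := ⟨u⟩
  rw [avgDegree_mul_card, ← Finset.add_sum_erase _ _ (Finset.mem_univ u),
    Finset.sum_congr rfl fun w hw => by
      rw [degree_eq_ite_of_center hu (Finset.ne_of_mem_erase hw)]]
  have h := SimpleGraph.degree_eq_sum_if_adj G (R := ℝ) u
  rw [← Finset.add_sum_erase _ _ (Finset.mem_univ u), if_neg (G.loopless.irrefl u), zero_add] at h
  push_cast
  rw [← h]
  ring

lemma lapMatrix_form_of_center {u : V} (hu : ∀ v w, G.Adj v w → v = u ∨ w = u) (x : V → ℝ) :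
    x ⬝ᵥ G.lapMatrix ℝ *ᵥ x = ∑ w ∈ G.neighborFinset u, (x u - x w) ^ 2 := by
  have hform := SimpleGraph.lapMatrix_toLinearMap₂' ℝ G x
  rw [toLinearMap₂'_apply'] at hform
  have hinner : ∀ w ∈ Finset.univ.erase u, ∑ j, (if G.Adj w j then (x w - x j) ^ 2 else 0) =
      if G.Adj u w then (x u - x w) ^ 2 else 0 := by
    intro w hw
    rw [Finset.sum_eq_single u]
    · simp only [G.adj_comm w u, sub_sq_comm (x w)]
    · intro j _ hj
      exact if_neg fun h => (hu w j h).elim (Finset.ne_of_mem_erase hw) hj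
    · simp
  have hu0 : ∑ w ∈ Finset.univ.erase u, (if G.Adj u w then (x u - x w) ^ 2 else 0) =
      ∑ w, if G.Adj u w then (x u - x w) ^ 2 else 0 := by
    rw [← Finset.add_sum_erase _ _ (Finset.mem_univ u), if_neg (G.loopless.irrefl u), zero_add]
  have hfilter : G.neighborFinset u = Finset.univ.filter (fun w => G.Adj u w) := by
    ext; simp
  rw [hform, ← Finset.add_sum_erase _ _ (Finset.mem_univ u), Finset.sum_congr rfl hinner, hu0,
    hfilter, Finset.sum_filter]
  ring

/-- For a star with isolated vertices, the second largest Laplacian eigenvalue is less than the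
average degree exactly when there is a single edge or the edges number more than half the
vertices. -/
lemma eigenvalues₀_one_lt_avgDegree_iff_of_center (h : 1 < Fintype.card V) {u : V}
    (hu : ∀ v w, G.Adj v w → v = u ∨ w = u) :
    (G.isHermitian_lapMatrix ℝ).eigenvalues₀ ⟨1, h⟩ < avgDegree G ↔
      G.degree u = 1 ∨ Fintype.card V < 2 * G.degree u := by
  have hn : (0 : ℝ) < Fintype.card V := by exact_mod_cast (by omega : 0 < Fintype.card V)
  have havg := avgDegree_mul_card_of_center hu
  constructor
  · intro hlt
    by_contra! hcon
    have hd1 : avgDegree G ≤ 1 := by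
      refine le_of_mul_le_mul_right ?_ hn
      rw [havg, one_mul]
      exact_mod_cast hcon.2
    rcases Nat.lt_or_ge (G.degree u) 2 with h2 | h2
    · have h0 : G.degree u = 0 := by omega
      have hd0 : avgDegree G = 0 := by
        rw [h0] at havg
        simpa [hn.ne'] using havg
      obtain ⟨a, ha⟩ := Fintype.exists_ne_of_one_lt_card h u
      refine hlt.not_ge (le_eigenvalues₀_one_of_not_adj h ha.symm (fun hadj => ?_) ?_ ?_)
      · have := (G.degree_pos_iff_exists_adj u).2 ⟨a, hadj⟩
        omega
      · rw [hd0]; positivity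
      · rw [hd0]; positivity
    -- Two leaves are nonadjacent and have degree 1 ≥ d.
    · rw [← G.card_neighborFinset_eq_degree] at h2
      obtain ⟨a, ha, b, hb, hab⟩ := Finset.one_lt_card.1 h2
      rw [SimpleGraph.mem_neighborFinset] at ha hb
      refine hlt.not_ge (le_eigenvalues₀_one_of_not_adj h hab
        (fun hadj => (hu a b hadj).elim ha.ne' hb.ne') ?_ ?_)
      · rw [degree_eq_ite_of_center hu ha.ne', if_pos ha]
        simpa using hd1
      · rw [degree_eq_ite_of_center hu hb.ne', if_pos hb]
        simpa using hd1
  · rintro (h1 | h2)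
    · obtain ⟨v, hv⟩ := Finset.card_eq_one.1 ((G.card_neighborFinset_eq_degree u).trans h1)
      -- With a single edge uv, the form vanishes on x_u = x_v.
      refine lt_of_le_of_lt ((G.isHermitian_lapMatrix ℝ).eigenvalues₀_one_le h (d := 0)
        (LinearMap.proj (R := ℝ) (φ := fun _ : V => ℝ) u - LinearMap.proj v) fun x hx => ?_) ?_
      · rw [lapMatrix_form_of_center hu, hv, Finset.sum_singleton]
        have : x u - x v = 0 := hx
        simp [this]
      · refine lt_of_mul_lt_mul_right ?_ hn.le
        rw [havg, h1, zero_mul]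
        norm_num
    -- On x_u = 0 the form is the sum of the squares over the leaves.
    · refine lt_of_le_of_lt ((G.isHermitian_lapMatrix ℝ).eigenvalues₀_one_le h (d := 1)
        (LinearMap.proj u) fun x hx => ?_) ?_
      · have hx : x u = 0 := hx
        rw [lapMatrix_form_of_center hu, one_mul, dotProduct]
        refine le_trans (le_of_eq ?_) (Finset.sum_le_sum_of_subset_of_nonneg
          (Finset.subset_univ (G.neighborFinset u)) fun i _ _ => mul_self_nonneg _)
        exact Finset.sum_congr rfl fun w _ => by rw [hx]; ring
      · refine lt_of_mul_lt_mul_right ?_ hn.le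
        rw [havg, one_mul]
        exact_mod_cast h2

end Star

/-! ### The range of r, and the theorem -/

lemma le_ceil_half_sub_two_iff (n r : ℕ) :
    (r : ℤ) ≤ ⌈(n : ℚ) / 2⌉ - 2 ↔ 2 * r + 2 < n := by
  have h : (r : ℤ) ≤ ⌈(n : ℚ) / 2⌉ - 2 ↔ (r : ℤ) + 1 < ⌈(n : ℚ) / 2⌉ := by omega
  rw [h, Int.lt_ceil, lt_div_iff₀ two_pos]
  push_cast
  rw [show ((r : ℚ) + 1) * 2 = ((2 * r + 2 : ℕ) : ℚ) by push_cast; ring, Nat.cast_lt]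

theorem theorem4p2 {V : Type*} [Fintype V] [DecidableEq V]
    (G : SimpleGraph V) [DecidableRel G.Adj]
    (n : ℕ) (hV : Fintype.card V = n) (hn : 2 ≤ n) :
    sigmaInvariant G = 1 ↔
      ∃ r : ℕ, ((r : ℤ) ≤ ⌈(n : ℚ) / 2⌉ - 2 ∨ (r : ℤ) = (n : ℤ) - 2) ∧
        Nonempty (G ≃g starWithIsolated (n - r - 1) r) := by
  subst hV
  have h : 1 < Fintype.card V := hn
  rw [sigmaInvariant_eq_one_iff G h]
  simp only [le_ceil_half_sub_two_iff]
  constructor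
  · intro hlt
    obtain ⟨u, hu⟩ := exists_center_of_eigenvalues₀_one_lt h hlt
    have hs := (eigenvalues₀_one_lt_avgDegree_iff_of_center h hu).1 hlt
    have hdeg := G.degree_lt_card_verts u
    -- With s = deg u and r = n − 1 − s, the condition s = 1 reads r = n − 2, and n < 2s reads 2r +
    -- 2 < n.
    refine ⟨Fintype.card V - 1 - G.degree u, by omega, ?_⟩
    have := nonempty_iso_starWithIsolated hu
    rwa [show Fintype.card V - (Fintype.card V - 1 - G.degree u) - 1 = G.degree u by omega]
  · rintro ⟨r, hr, ⟨f⟩⟩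
    obtain ⟨u, hu, hs⟩ := exists_center_of_iso f
    exact (eigenvalues₀_one_lt_avgDegree_iff_of_center h hu).2 (by omega)
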